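/- For $|\rho|\le 1$ let $\Sigma_\rho=\begin{bmatrix}1&\rho\\ \rho&1\end{bmatrix}$. For $n\in\mathbb N$ consider testing, from $\mathsf X=(X_1,\dots,X_n)\in\mathbb R^n$ and $\mathsf Y=(Y_1,\dots,Y_n)\in\mathbb R^n$, \[ \mathcal H_0:\ (X_1,Y_1),\dots,(X_n,Y_n)\overset{\text{i.i.d.}}{\sim}\mathcal N(\mathbf 0,\Sigma_0) \qquad\text{against}\qquad \mathcal H_1:\ (X_1,Y_{\sigma(1)}),\dots,(X_n,Y_{\sigma(n)})\overset{\text{i.i.d.}}{\sim}\mathcal N(\mathbf 0,\Sigma_\rho)\ \text{given }\sigma, \] where $\sigma$ is a uniformly random permutation of $\{1,\dots,n\}$. Let $\mathbb P_{\mathcal H_0}$ and $\mathbb P_{\mathcal H_1}$ be the laws of $(\mathsf X,\mathsf Y)$ under the two hypotheses, the second one averaged over $\sigma$, and let \[ \mathsf R^\star=\mathsf R^\star(\rho,n)=\inf_{\phi}\Big(\mathbb P_{\mathcal H_0}[\phi(\mathsf X,\mathsf Y)=1]+\mathbb P_{\mathcal H_1}[\phi(\mathsf X,\mathsf Y)=0]\Big)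 \] be the optimal Bayes risk, the infimum being over all measurable tests $\phi:\mathbb R^n\times\mathbb R^n\to\{0,1\}$. Theorem (impossibility of strong detection). Let $(\rho_k,n_k)_{k\in\mathbb N}$ be any sequence with $|\rho_k|\le1$, $n_k\in\mathbb N$ and $\rho_k^2=1-\Omega(1)$, that is, there is $\varepsilon>0$ with $\rho_k^2\le 1-\varepsilon$ for all $k$. Then $\mathsf R^\star(\rho_k,n_k)=\Omega(1)$, that is, there is $c>0$ with $\mathsf R^\star(\rho_k,n_k)\ge c$ for all $k$. In particular, strong detection is impossible: $\mathsf R^\star(\rho_k,n_k)$ does not converge to $0$ as $k\to\infty$. -/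

import Mathlib

open MeasureTheory ProbabilityTheory Filter Topology

noncomputable section

namespace PermutedCorrelation

/-- The covariance matrix `Σ_ρ` with unit variances and correlation `ρ`. -/
def corrMatrix (ρ : ℝ) : Matrix (Fin 2) (Fin 2) ℝ := !![1, ρ; ρ, 1]

/-- The bivariate normal distribution `N(0, Σ_ρ)`. -/
def pairLaw (ρ : ℝ) : Measure (EuclideanSpace ℝ (Fin 2)) :=
  multivariateGaussian 0 (corrMatrix ρ)

/-- The observation space `ℝⁿ × ℝⁿ` of the pair `(X, Y)`. -/
abbrev Obs (n : ℕ) : Type := (Fin n → ℝ) × (Fin n → ℝ)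

/-- The observation `(X, Y)` for which the matched pairs `(X_i, Y_{σ(i)})` are the given `z i`,
that is, `X_i = (z i)_0` and `Y_{σ(i)} = (z i)_1`. -/
def unmatch {n : ℕ} (σ : Equiv.Perm (Fin n)) (z : Fin n → EuclideanSpace ℝ (Fin 2)) : Obs n :=
  (fun i => z i 0, fun j => z (σ.symm j) 1)

/-- The law of `(X, Y)` under the null hypothesis: `(X_1, Y_1), …, (X_n, Y_n)` are i.i.d. with
law `N(0, Σ_0)`. -/
def nullLaw (n : ℕ) : Measure (Obs n) :=
  (Measure.pi fun _ : Fin n => pairLaw 0).map (unmatch 1)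

/-- The law of `(X, Y)` under the alternative given the permutation `σ`:
`(X_1, Y_{σ(1)}), …, (X_n, Y_{σ(n)})` are i.i.d. with law `N(0, Σ_ρ)`. -/
def altLawGiven (n : ℕ) (ρ : ℝ) (σ : Equiv.Perm (Fin n)) : Measure (Obs n) :=
  (Measure.pi fun _ : Fin n => pairLaw ρ).map (unmatch σ)

/-- The law of `(X, Y)` under the alternative: the average of `altLawGiven n ρ σ` over a
uniformly random permutation `σ`. -/
def altLaw (n : ℕ) (ρ : ℝ) : Measure (Obs n) :=
  (n.factorial : ENNReal)⁻¹ • ∑ σ : Equiv.Perm (Fin n), altLawGiven n ρ σ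

/-- The risk of a test: the sum of its Type-I and Type-II error probabilities. -/
def risk (n : ℕ) (ρ : ℝ) (φ : Obs n → Fin 2) : ℝ :=
  (nullLaw n).real {p | φ p = 1} + (altLaw n ρ).real {p | φ p = 0}

/-- The optimal Bayes risk: the infimum of the risk over all (measurable) tests. -/
def bayesRisk (n : ℕ) (ρ : ℝ) : ℝ :=
  ⨅ φ : {φ : Obs n → Fin 2 // Measurable φ}, risk n ρ φ.1

/-- `f = Ω(g)` for real sequences: `g ≤ C f` for some constant `C > 0`, at every index. -/
def IsBigOmega (f g : ℕ → ℝ) : Prop := ∃ C : ℝ, 0 < C ∧ ∀ k, g k ≤ C * f k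

/-- The sequence `(ρ_k, n_k)` is admissible for strong detection. -/
def StrongDetection (ρ : ℕ → ℝ) (n : ℕ → ℕ) : Prop :=
  Tendsto (fun k => bayesRisk (n k) (ρ k)) atTop (𝓝 0)

end PermutedCorrelation

end

noncomputable section

namespace PermutedCorrelation

open scoped ENNReal NNReal

/-! This is the second moment method. Let `L` be the likelihood ratio averaged over permutations,
and suppose its second moment under the null is at most `M`. By Cauchy–Schwarz, `q ^ 2 ≤ p * M` for
the null and alternative probabilities `p`, `q` of any event, so `p` and `1 - q` cannot both be
small. It remains to bound the second moment uniformly in `n`.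

Given `σ`, the likelihood ratio is a product of Mehler kernels. In the second moment, integrating
out `Y` composes kernels in pairs (`lintegral_mehler_mul_mehler`) and leaves cyclic integrals of the
kernel of parameter `r = ρ ^ 2` along a permutation. Such integrals depend only on the traces `1 /
(1 - a)` of the kernels (`lintegral_prod_perm_eq`). The diagonal matrix with entries `a ^ k`, which
lists the eigenvalues of the Mehler operator, has the same traces, so each cyclic integral becomes a
sum over tuples of naturals fixed by the permutation.

Averaging over permutations counts tuples up to reordering (`sum_perm_tsum_fixed`), hence gives the
generating function of nondecreasing tuples. That is at most `∏ 1 / (1 - r ^ j)` over `1 ≤ j ≤ n`,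
which `exp (1 / (1 - r) ^ 2)` bounds for every `n`. -/

/-! ### Gaussian integrals of the Mehler kernel -/

/-- The Mehler kernel: the density of the bivariate normal law with unit variances and
correlation `ρ` with respect to the standard Gaussian measure on the plane. -/
def mehler (ρ x y : ℝ) : ℝ≥0∞ :=
  ENNReal.ofReal ((√(1 - ρ ^ 2))⁻¹ *
    Real.exp ((2 * ρ * x * y - ρ ^ 2 * (x ^ 2 + y ^ 2)) / (2 * (1 - ρ ^ 2))))

@[fun_prop]
lemma measurable_mehler {α : Type*} [MeasurableSpace α] {ρ : ℝ} {f g : α → ℝ}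
    (hf : Measurable f) (hg : Measurable g) : Measurable fun x => mehler ρ (f x) (g x) := by
  unfold mehler
  fun_prop

lemma mehler_zero (x y : ℝ) : mehler 0 x y = 1 := by simp [mehler]

lemma mehler_comm (ρ x y : ℝ) : mehler ρ x y = mehler ρ y x := by
  unfold mehler
  congr 4
  ring

lemma lintegral_stdGaussian_eq (f : ℝ → ℝ≥0∞) (hf : Measurable f) :
    ∫⁻ y, f y ∂gaussianReal 0 1 = ∫⁻ y, gaussianPDF 0 1 y * f y := by
  rw [gaussianReal_of_var_ne_zero 0 one_ne_zero,
    lintegral_withDensity_eq_lintegral_mul _ (measurable_gaussianPDF 0 1) hf]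
  rfl

/-- The Gaussian integral of the exponential of a quadratic polynomial. -/
lemma lintegral_exp_quadratic {A : ℝ} (hA : 0 < 1 - 2 * A) (B : ℝ) :
    ∫⁻ y, ENNReal.ofReal (Real.exp (A * y ^ 2 + B * y)) ∂gaussianReal 0 1 =
      ENNReal.ofReal ((√(1 - 2 * A))⁻¹ * Real.exp (B ^ 2 / (2 * (1 - 2 * A)))) := by
  rw [lintegral_stdGaussian_eq _ (by fun_prop)]
  have hv : (1 - 2 * A).toNNReal⁻¹ ≠ 0 := by
    simpa using hA
  -- Completing the square gives a multiple of the Gaussian density of mean `B / (1 - 2A)` and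
  -- variance `1 / (1 - 2A)`.
  have key : ∀ y, gaussianPDF 0 1 y * ENNReal.ofReal (Real.exp (A * y ^ 2 + B * y)) =
      ENNReal.ofReal ((√(1 - 2 * A))⁻¹ * Real.exp (B ^ 2 / (2 * (1 - 2 * A)))) *
        gaussianPDF (B / (1 - 2 * A)) (1 - 2 * A).toNNReal⁻¹ y := by
    intro y
    rw [gaussianPDF, gaussianPDF, ← ENNReal.ofReal_mul (gaussianPDFReal_nonneg _ _ _),
      ← ENNReal.ofReal_mul (by positivity)]
    congr 1
    simp only [gaussianPDFReal, NNReal.coe_inv, Real.coe_toNNReal _ hA.le, NNReal.coe_one]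
    generalize h : 1 - 2 * A = w at *
    obtain rfl : A = (1 - w) / 2 := by linarith
    have hs : √w ≠ 0 := (Real.sqrt_pos.2 hA).ne'
    rw [mul_one, Real.sqrt_mul' _ (inv_pos.2 hA).le, Real.sqrt_inv]
    have hexp : Real.exp (-(y - 0) ^ 2 / (2 * 1)) * Real.exp ((1 - w) / 2 * y ^ 2 + B * y) =
        Real.exp (B ^ 2 / (2 * w)) * Real.exp (-(y - B / w) ^ 2 / (2 * w⁻¹)) := by
      rw [← Real.exp_add, ← Real.exp_add]
      congr 1
      field_simp
      ring
    rw [mul_assoc, hexp]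
    field_simp
  simp_rw [key]
  rw [lintegral_const_mul _ (measurable_gaussianPDF _ _), lintegral_gaussianPDF_eq_one _ hv,
    mul_one]

/-- The semigroup property of the Mehler kernel. -/
lemma lintegral_mehler_mul_mehler {a b : ℝ} (ha : a ^ 2 < 1) (hb : b ^ 2 < 1) (x z : ℝ) :
    ∫⁻ y, mehler a x y * mehler b y z ∂gaussianReal 0 1 = mehler (a * b) x z := by
  have ha' : 0 < 1 - a ^ 2 := by linarith
  have hb' : 0 < 1 - b ^ 2 := by linarith
  have hab : 0 < 1 - (a * b) ^ 2 := by nlinarith [sq_nonneg a, sq_nonneg b]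
  set A : ℝ := -(a ^ 2 / (1 - a ^ 2) + b ^ 2 / (1 - b ^ 2)) / 2 with hAdef
  set B : ℝ := a * x / (1 - a ^ 2) + b * z / (1 - b ^ 2) with hBdef
  have hA : 1 - 2 * A = (1 - (a * b) ^ 2) / ((1 - a ^ 2) * (1 - b ^ 2)) := by
    rw [hAdef]; field_simp; ring
  have hApos : 0 < 1 - 2 * A := by rw [hA]; positivity
  set c : ℝ := (√(1 - a ^ 2))⁻¹ * (√(1 - b ^ 2))⁻¹ *
    Real.exp (-(a ^ 2 * x ^ 2) / (2 * (1 - a ^ 2)) - b ^ 2 * z ^ 2 / (2 * (1 - b ^ 2))) with hc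
  have hc0 : 0 ≤ c := by positivity
  have key : ∀ y, mehler a x y * mehler b y z =
      ENNReal.ofReal c * ENNReal.ofReal (Real.exp (A * y ^ 2 + B * y)) := by
    intro y
    rw [mehler, mehler, ← ENNReal.ofReal_mul (by positivity), ← ENNReal.ofReal_mul hc0, hc,
      mul_mul_mul_comm, ← Real.exp_add, mul_assoc (_ * _) (Real.exp _), ← Real.exp_add]
    congr 3
    rw [hAdef, hBdef]
    field_simp
    ring
  simp_rw [key]
  rw [lintegral_const_mul _ (by fun_prop), lintegral_exp_quadratic hApos, mehler,
    ← ENNReal.ofReal_mul hc0]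
  congr 1
  rw [hc, hA, mul_assoc (_ * _), mul_left_comm (Real.exp _), ← Real.exp_add, ← mul_assoc]
  congr 1
  · rw [Real.sqrt_div hab.le, Real.sqrt_mul ha'.le]
    have h1 := (Real.sqrt_pos.2 ha').ne'
    have h2 := (Real.sqrt_pos.2 hb').ne'
    have h3 := (Real.sqrt_pos.2 hab).ne'
    field_simp
  · congr 1
    rw [hBdef]
    rw [mul_pow] at hab ⊢
    have := hab.ne'
    field_simp
    ring

/-- The trace of the Mehler kernel. -/
lemma lintegral_mehler_diag {a : ℝ} (ha : a ^ 2 < 1) :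
    ∫⁻ x, mehler a x x ∂gaussianReal 0 1 = ENNReal.ofReal (1 - a)⁻¹ := by
  have ha' : 0 < 1 - a ^ 2 := by linarith
  have h1 : 0 < 1 + a := by nlinarith [abs_lt.1 ((sq_lt_one_iff_abs_lt_one a).1 ha)]
  have h2 : 0 < 1 - a := by nlinarith [abs_lt.1 ((sq_lt_one_iff_abs_lt_one a).1 ha)]
  have hA : 1 - 2 * (a / (1 + a)) = (1 - a) / (1 + a) := by field_simp; ring
  have key : ∀ x, mehler a x x = ENNReal.ofReal (√(1 - a ^ 2))⁻¹ *
      ENNReal.ofReal (Real.exp (a / (1 + a) * x ^ 2 + 0 * x)) := by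
    intro x
    rw [mehler, ← ENNReal.ofReal_mul (by positivity)]
    congr 3
    rw [show 1 - a ^ 2 = (1 - a) * (1 + a) by ring]
    field_simp
    ring
  simp_rw [key]
  rw [lintegral_const_mul _ (by fun_prop), lintegral_exp_quadratic (by rw [hA]; positivity),
    ← ENNReal.ofReal_mul (by positivity), hA]
  congr 1
  rw [show 1 - a ^ 2 = (1 - a) * (1 + a) by ring, Real.sqrt_div h2.le, Real.sqrt_mul h2.le]
  have := (Real.sqrt_pos.2 h1).ne'
  have := (Real.sqrt_pos.2 h2).ne'
  have := Real.sq_sqrt h2.le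
  simp
  field_simp
  rw [this]

lemma gaussianPDF_mul_mehler {ρ : ℝ} (hρ : ρ ^ 2 < 1) (x y : ℝ) :
    gaussianPDF 0 1 y * mehler ρ x y = gaussianPDF (ρ * x) (1 - ρ ^ 2).toNNReal y := by
  have h : 0 < 1 - ρ ^ 2 := by linarith
  rw [gaussianPDF, gaussianPDF, mehler, ← ENNReal.ofReal_mul (gaussianPDFReal_nonneg _ _ _)]
  congr 1
  simp only [gaussianPDFReal, Real.coe_toNNReal _ h.le, NNReal.coe_one]
  have hexp : Real.exp (-(y - 0) ^ 2 / (2 * 1)) *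
      Real.exp ((2 * ρ * x * y - ρ ^ 2 * (x ^ 2 + y ^ 2)) / (2 * (1 - ρ ^ 2))) =
        Real.exp (-(y - ρ * x) ^ 2 / (2 * (1 - ρ ^ 2))) := by
    rw [← Real.exp_add]
    congr 1
    field_simp
    ring
  rw [mul_mul_mul_comm, hexp, Real.sqrt_mul' _ zero_le_one, Real.sqrt_mul' _ h.le, Real.sqrt_one]
  have := (Real.sqrt_pos.2 h).ne'
  field_simp

/-! ### Cyclic integrals of kernel semigroups -/

/-- Integrate out the first coordinate of a product measure. -/
lemma lintegral_pi_fin_succ {X : Type*} [MeasurableSpace X] (μ : Measure X) [SigmaFinite μ]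
    {n : ℕ} {f : (Fin (n + 1) → X) → ℝ≥0∞} (hf : Measurable f) :
    ∫⁻ x, f x ∂Measure.pi (fun _ : Fin (n + 1) => μ) =
      ∫⁻ y, ∫⁻ t, f (Fin.cons t y) ∂μ ∂Measure.pi (fun _ : Fin n => μ) := by
  have h := (measurePreserving_piFinSuccAbove (fun _ : Fin (n + 1) => μ) 0).symm
  rw [← h.lintegral_comp hf]
  refine (lintegral_prod_symm' (μ := μ) (ν := Measure.pi fun _ : Fin n => μ) _
    (hf.comp h.measurable)).trans (lintegral_congr fun y => lintegral_congr fun t => ?_)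
  exact congr_arg f (Fin.insertNth_zero' t y)

lemma lintegral_pi_prod {X : Type*} [MeasurableSpace X] (μ : Measure X) [SigmaFinite μ]
    {n : ℕ} {f : Fin n → X → ℝ≥0∞} (hf : ∀ i, Measurable (f i)) :
    ∫⁻ x, ∏ i, f i (x i) ∂Measure.pi (fun _ : Fin n => μ) = ∏ i, ∫⁻ x, f i x ∂μ := by
  induction n with
  | zero => simp
  | succ n ih =>
    rw [lintegral_pi_fin_succ μ (by fun_prop)]
    simp only [Fin.prod_univ_succ, Fin.cons_zero, Fin.cons_succ]
    simp_rw [lintegral_mul_const _ (hf 0)]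
    rw [lintegral_const_mul _ (by fun_prop), ih fun i => hf i.succ]

/-- A family of kernels on `(X, μ)`, indexed by a semigroup, which is multiplicative and has the
given traces. -/
structure IsKernelSemigroup {A X : Type*} [Semigroup A] [MeasurableSpace X] (μ : Measure X)
    (K : A → X → X → ℝ≥0∞) (tr : A → ℝ≥0∞) : Prop where
  measurable : ∀ a, Measurable fun p : X × X => K a p.1 p.2
  comp : ∀ a b x z, ∫⁻ y, K a x y * K b y z ∂μ = K (a * b) x z
  trace : ∀ a, ∫⁻ x, K a x x ∂μ = tr a

namespace IsKernelSemigroup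

variable {A X : Type*} [Semigroup A] [MeasurableSpace X] {μ : Measure X}
  {K : A → X → X → ℝ≥0∞} {tr : A → ℝ≥0∞} {n : ℕ}

lemma measurable_apply (h : IsKernelSemigroup μ K tr) (a : A) {α : Type*} [MeasurableSpace α]
    {f g : α → X} (hf : Measurable f) (hg : Measurable g) :
    Measurable fun x => K a (f x) (g x) :=
  (h.measurable a).comp (hf.prodMk hg)

lemma measurable_prod (h : IsKernelSemigroup μ K tr) (a : Fin n → A) (σ : Fin n → Fin n) :
    Measurable fun x : Fin n → X => ∏ i, K (a i) (x i) (x (σ i)) :=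
  Finset.measurable_prod _ fun i _ =>
    h.measurable_apply (a i) (measurable_pi_apply i) (measurable_pi_apply (σ i))

variable [SigmaFinite μ]

/-- The point `0` is a cycle of length one, so its variable occurs in one kernel only and
contributes a trace. -/
lemma lintegral_prod_of_fixed (h : IsKernelSemigroup μ K tr) (a : Fin (n + 1) → A)
    (e : Equiv.Perm (Fin n)) :
    ∫⁻ x, ∏ i, K (a i) (x i) (x (Equiv.Perm.decomposeFin.symm (0, e) i))
        ∂Measure.pi (fun _ : Fin (n + 1) => μ) =
      tr (a 0) * ∫⁻ x, ∏ i, K (a i.succ) (x i) (x (e i)) ∂Measure.pi (fun _ : Fin n => μ) := by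
  rw [lintegral_pi_fin_succ μ (h.measurable_prod a _),
    ← lintegral_const_mul _ (h.measurable_prod (fun i => a i.succ) e)]
  refine lintegral_congr fun y => ?_
  simp only [Fin.prod_univ_succ, Equiv.Perm.decomposeFin_symm_apply_zero,
    Equiv.Perm.decomposeFin_symm_apply_succ, Equiv.swap_self, Equiv.refl_apply, Fin.cons_zero,
    Fin.cons_succ]
  have hm : Measurable fun t => K (a 0) t t := h.measurable_apply _ measurable_id measurable_id
  rw [lintegral_mul_const _ hm, h.trace]

/-- Here the permutation runs `i.succ ↦ 0 ↦ (e i).succ`. Integrating out the variable at `0`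
composes the two adjacent kernels and shortens the cycle. The merged kernel has a new parameter,
hence the label `a` at each point. -/
lemma lintegral_prod_of_moved (h : IsKernelSemigroup μ K tr) (a : Fin (n + 1) → A)
    (i : Fin n) (e : Equiv.Perm (Fin n)) :
    ∫⁻ x, ∏ l, K (a l) (x l) (x (Equiv.Perm.decomposeFin.symm ((e i).succ, e) l))
        ∂Measure.pi (fun _ : Fin (n + 1) => μ) =
      ∫⁻ x, ∏ l, K (Function.update (fun l => a l.succ) i (a i.succ * a 0) l) (x l) (x (e l))
        ∂Measure.pi (fun _ : Fin n => μ) := by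
  rw [lintegral_pi_fin_succ μ (h.measurable_prod a _)]
  refine lintegral_congr fun y => ?_
  have key : ∀ t, ∏ l, K (a l) ((Fin.cons t y : Fin (n + 1) → X) l)
      ((Fin.cons t y : Fin (n + 1) → X) (Equiv.Perm.decomposeFin.symm ((e i).succ, e) l)) =
      K (a i.succ) (y i) t * K (a 0) t (y (e i)) *
        ∏ l ∈ Finset.univ.erase i, K (a l.succ) (y l) (y (e l)) := by
    intro t
    rw [Fin.prod_univ_succ, ← Finset.mul_prod_erase _ _ (Finset.mem_univ i), ← mul_assoc]
    congr 1
    · simp [mul_comm]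
    · refine Finset.prod_congr rfl fun l hl => ?_
      have hne : (e l).succ ≠ (e i).succ := fun h' =>
        (Finset.mem_erase.1 hl).1 (e.injective (Fin.succ_injective _ h'))
      rw [Equiv.Perm.decomposeFin_symm_apply_succ,
        Equiv.swap_apply_of_ne_of_ne (Fin.succ_ne_zero _) hne, Fin.cons_succ, Fin.cons_succ]
  simp_rw [key]
  have hm : Measurable fun t => K (a i.succ) (y i) t * K (a 0) t (y (e i)) :=
    (h.measurable_apply _ measurable_const measurable_id).mul
      (h.measurable_apply _ measurable_id measurable_const)
  rw [lintegral_mul_const _ hm, h.comp, ← Finset.mul_prod_erase _ _ (Finset.mem_univ i),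
    Function.update_self]
  congr 1
  refine Finset.prod_congr rfl fun l hl => ?_
  rw [Function.update_of_ne (Finset.mem_erase.1 hl).1]

/-- The cyclic integrals along a permutation depend only on the traces of the kernels. -/
theorem lintegral_prod_perm_eq (h : IsKernelSemigroup μ K tr) {X' : Type*} [MeasurableSpace X']
    {μ' : Measure X'} [SigmaFinite μ'] {K' : A → X' → X' → ℝ≥0∞}
    (h' : IsKernelSemigroup μ' K' tr) (a : Fin n → A) (σ : Equiv.Perm (Fin n)) :
    ∫⁻ x, ∏ i, K (a i) (x i) (x (σ i)) ∂Measure.pi (fun _ : Fin n => μ) =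
      ∫⁻ x, ∏ i, K' (a i) (x i) (x (σ i)) ∂Measure.pi (fun _ : Fin n => μ') := by
  induction n with
  | zero => simp
  | succ n ih =>
    obtain ⟨⟨p, e⟩, rfl⟩ := Equiv.Perm.decomposeFin.symm.surjective σ
    induction p using Fin.cases with
    | zero => rw [h.lintegral_prod_of_fixed, h'.lintegral_prod_of_fixed, ih]
    | succ j =>
      obtain ⟨i, rfl⟩ := e.surjective j
      rw [h.lintegral_prod_of_moved, h'.lintegral_prod_of_moved, ih]

end IsKernelSemigroup

/-- The Mehler kernels form a semigroup. -/
lemma isKernelSemigroup_mehler :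
    IsKernelSemigroup (gaussianReal 0 1) (fun a : Set.Ico (0 : ℝ) 1 => mehler a)
      (fun a => ENNReal.ofReal (1 - (a : ℝ))⁻¹) where
  measurable a := by fun_prop
  comp a b x z := by
    have hsq : ∀ c : Set.Ico (0 : ℝ) 1, (c : ℝ) ^ 2 < 1 := fun c => by
      nlinarith [c.2.1, c.2.2]
    simpa using lintegral_mehler_mul_mehler (hsq a) (hsq b) x z
  trace a := lintegral_mehler_diag (by nlinarith [a.2.1, a.2.2])

/-- The diagonal matrices with entries the powers of a number form a semigroup of kernels. -/
lemma isKernelSemigroup_diagonal :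
    IsKernelSemigroup (Measure.count : Measure ℕ)
      (fun (a : Set.Ico (0 : ℝ) 1) k l => if k = l then ENNReal.ofReal a ^ k else 0)
      (fun a => ENNReal.ofReal (1 - (a : ℝ))⁻¹) where
  measurable a := measurable_of_countable _
  comp a b k l := by
    rw [lintegral_count, tsum_eq_single k (by intro m hm; simp [hm.symm])]
    by_cases hkl : k = l
    · simp [hkl, mul_pow, ENNReal.ofReal_mul a.2.1]
    · simp [hkl]
  trace a := by
    rw [lintegral_count]
    simp only [if_true]
    rw [ENNReal.tsum_geometric, ENNReal.ofReal_inv_of_pos (by linarith [a.2.2]),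
      ENNReal.ofReal_sub _ a.2.1, ENNReal.ofReal_one]

lemma pi_count_eq_count (n : ℕ) :
    Measure.pi (fun _ : Fin n => (Measure.count : Measure ℕ)) = Measure.count := by
  refine Measure.ext_of_singleton fun k => ?_
  rw [Measure.pi_singleton]
  simp

/-- On the diagonal side, the product vanishes unless `k` is constant along the cycles of `σ`. -/
lemma lintegral_prod_mehler_perm {n : ℕ} {r : ℝ} (hr0 : 0 ≤ r) (hr1 : r < 1)
    (σ : Equiv.Perm (Fin n)) :
    ∫⁻ x, ∏ i, mehler r (x i) (x (σ i)) ∂Measure.pi (fun _ : Fin n => gaussianReal 0 1) =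
      ∑' k : Fin n → ℕ, if k ∘ σ = k then ENNReal.ofReal r ^ ∑ i, k i else 0 := by
  have h := isKernelSemigroup_mehler.lintegral_prod_perm_eq isKernelSemigroup_diagonal
    (fun _ : Fin n => ⟨r, hr0, hr1⟩) σ
  simp only [pi_count_eq_count, lintegral_count] at h
  rw [h]
  refine tsum_congr fun k => ?_
  split_ifs with hk
  · rw [← Finset.prod_pow_eq_pow_sum]
    exact Finset.prod_congr rfl fun i _ => if_pos (congr_fun hk i).symm
  · obtain ⟨i, hi⟩ := Function.ne_iff.1 hk
    exact Finset.prod_eq_zero (Finset.mem_univ i) (if_neg (Ne.symm hi))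

/-! ### Averaging over permutations and the generating function -/

/-- As many permutations fix a tuple as sort it. -/
lemma card_comp_eq_self_eq_card_monotone {n : ℕ} (k : Fin n → ℕ) :
    (Finset.univ.filter fun σ : Equiv.Perm (Fin n) => k ∘ σ = k).card =
      (Finset.univ.filter fun σ : Equiv.Perm (Fin n) => Monotone (k ∘ σ)).card := by
  -- `k ∘ σ = k` holds exactly when `σ * Tuple.sort k` sorts `k`.
  refine Finset.card_equiv (Equiv.mulRight (Tuple.sort k)) fun σ => ?_
  simp only [Finset.mem_filter, Finset.mem_univ, true_and, Equiv.coe_mulRight]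
  rw [← Tuple.comp_sort_eq_comp_iff_monotone, Equiv.Perm.coe_mul, ← Function.comp_assoc]
  exact ((Tuple.sort k).surjective.injective_comp_right.eq_iff).symm

open Classical in
/-- The generating function of the nondecreasing `n`-tuples. -/
def monotoneSum (n : ℕ) (q : ℝ≥0∞) : ℝ≥0∞ :=
  ∑' k : Fin n → ℕ, if Monotone k then q ^ ∑ i, k i else 0

/-- For each tuple, fixing permutations are exchanged for sorting ones; then for each `σ`,
reindexing the tuples by `σ` gives the nondecreasing sum, which no longer depends on `σ`. -/
lemma sum_perm_tsum_fixed (n : ℕ) (q : ℝ≥0∞) :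
    ∑ σ : Equiv.Perm (Fin n), ∑' k : Fin n → ℕ, (if k ∘ σ = k then q ^ ∑ i, k i else 0) =
      n.factorial * monotoneSum n q := by
  classical
  have h1 : ∀ σ : Equiv.Perm (Fin n),
      ∑' k : Fin n → ℕ, (if Monotone (k ∘ σ) then q ^ ∑ i, k i else 0) = monotoneSum n q := by
    intro σ
    rw [monotoneSum, ← (Equiv.arrowCongr σ.symm (Equiv.refl ℕ)).tsum_eq
      fun k => if Monotone k then q ^ ∑ i, k i else 0]
    refine tsum_congr fun k => ?_
    have hk : Equiv.arrowCongr σ.symm (Equiv.refl ℕ) k = k ∘ σ := by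
      ext; simp [Equiv.arrowCongr]
    rw [hk]
    simp only [Function.comp_apply, Equiv.sum_comp σ k]
  have h2 : ∀ k : Fin n → ℕ, ∑ σ : Equiv.Perm (Fin n), (if k ∘ σ = k then q ^ ∑ i, k i else 0) =
      ∑ σ : Equiv.Perm (Fin n), (if Monotone (k ∘ σ) then q ^ ∑ i, k i else 0) := by
    intro k
    rw [← Finset.sum_filter, ← Finset.sum_filter, Finset.sum_const, Finset.sum_const,
      card_comp_eq_self_eq_card_monotone]
  rw [← Summable.tsum_finsetSum fun _ _ => ENNReal.summable]
  simp_rw [h2]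
  rw [Summable.tsum_finsetSum fun _ _ => ENNReal.summable]
  simp_rw [h1]
  simp [Fintype.card_perm]

lemma monotoneSum_zero (q : ℝ≥0∞) : monotoneSum 0 q = 1 := by
  rw [monotoneSum, tsum_eq_single default (fun k hk => (hk (Subsingleton.elim _ _)).elim)]
  simp [Subsingleton.monotone]

/-- Subtracting the least entry `k 0` from the others leaves a nondecreasing `n`-tuple and lowers
the total by `(n + 1) * k 0`. Injectivity of this map suffices for the upper bound. -/
lemma monotoneSum_succ_le (n : ℕ) (q : ℝ≥0∞) :
    monotoneSum (n + 1) q ≤ (1 - q ^ (n + 1))⁻¹ * monotoneSum n q := by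
  classical
  rw [← ENNReal.tsum_geometric]
  simp only [monotoneSum]
  simp_rw [← ENNReal.tsum_mul_right, ← ENNReal.tsum_mul_left]
  rw [← ENNReal.tsum_prod
    (f := fun m (k : Fin n → ℕ) => (q ^ (n + 1)) ^ m * if Monotone k then q ^ ∑ i, k i else 0)]
  let g : {k : Fin (n + 1) → ℕ // Monotone k} → ℕ × (Fin n → ℕ) :=
    fun k => (k.1 0, fun i => k.1 i.succ - k.1 0)
  have hg : Function.Injective g := by
    rintro ⟨k, hk⟩ ⟨l, hl⟩ h
    simp only [g, Prod.mk.injEq] at h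
    ext i
    induction i using Fin.cases with
    | zero => exact h.1
    | succ i =>
      have h1 := hk (Fin.zero_le i.succ)
      have h2 := hl (Fin.zero_le i.succ)
      have h3 := congr_fun h.2 i
      simp only at h3 ⊢
      omega
  have hs : ∑' k : Fin (n + 1) → ℕ, (if Monotone k then q ^ ∑ i, k i else 0) =
      ∑' k : {k : Fin (n + 1) → ℕ // Monotone k}, q ^ ∑ i, k.1 i := by
    refine Eq.trans ?_
      (tsum_subtype {k : Fin (n + 1) → ℕ | Monotone k} (fun k => q ^ ∑ i, k i)).symm
    exact tsum_congr fun k => by simp [Set.indicator_apply]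
  rw [hs]
  refine le_trans (le_of_eq (tsum_congr fun k => ?_)) (ENNReal.tsum_comp_le_tsum_of_injective hg _)
  have hmono : Monotone fun i : Fin n => k.1 i.succ - k.1 0 := fun i j hij =>
    Nat.sub_le_sub_right (k.2 (Fin.succ_le_succ_iff.2 hij)) _
  simp only [g, if_pos hmono]
  rw [← pow_mul, ← pow_add, Fin.sum_univ_succ]
  congr 1
  have : ∀ i : Fin n, k.1 i.succ = (k.1 i.succ - k.1 0) + k.1 0 := fun i =>
    (Nat.sub_add_cancel (k.2 (Fin.zero_le _))).symm
  rw [Finset.sum_congr rfl fun i _ => this i, Finset.sum_add_distrib]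
  simp
  ring

lemma inv_one_sub_le_exp {r : ℝ} (hr0 : 0 ≤ r) (hr1 : r < 1) (n : ℕ) :
    (1 - ENNReal.ofReal r ^ (n + 1))⁻¹ ≤ ENNReal.ofReal (Real.exp (r ^ (n + 1) / (1 - r))) := by
  have hpow : r ^ (n + 1) ≤ r := pow_le_of_le_one hr0 hr1.le (by simp)
  have hp0 : 0 ≤ r ^ (n + 1) := pow_nonneg hr0 _
  rw [← ENNReal.ofReal_pow hr0, ← ENNReal.ofReal_one, ← ENNReal.ofReal_sub _ hp0,
    ← ENNReal.ofReal_inv_of_pos (by linarith)]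
  refine ENNReal.ofReal_le_ofReal ?_
  -- With `x = r ^ (n + 1) ≤ r`: `1 / (1 - x) = 1 + x / (1 - x) ≤ 1 + x / (1 - r)`.
  have h1 : (1 - r ^ (n + 1))⁻¹ ≤ r ^ (n + 1) / (1 - r) + 1 := by
    have h2 : (1 - r ^ (n + 1))⁻¹ = r ^ (n + 1) / (1 - r ^ (n + 1)) + 1 := by
      have : 1 - r ^ (n + 1) ≠ 0 := by linarith
      field_simp
      ring
    rw [h2]
    gcongr
  exact h1.trans (Real.add_one_le_exp _)

lemma monotoneSum_le {r : ℝ} (hr0 : 0 ≤ r) (hr1 : r < 1) (n : ℕ) :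
    monotoneSum n (ENNReal.ofReal r) ≤ ENNReal.ofReal (Real.exp (1 / (1 - r) ^ 2)) := by
  have h : ∀ n, monotoneSum n (ENNReal.ofReal r) ≤
      ENNReal.ofReal (Real.exp ((∑ j ∈ Finset.range n, r ^ (j + 1)) / (1 - r))) := by
    intro n
    induction n with
    | zero => simp [monotoneSum_zero]
    | succ n ih =>
      refine (monotoneSum_succ_le n _).trans ?_
      rw [Finset.sum_range_succ, add_div, Real.exp_add, mul_comm (Real.exp _),
        ENNReal.ofReal_mul (Real.exp_pos _).le]
      exact mul_le_mul' (inv_one_sub_le_exp hr0 hr1 n) ih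
  refine (h n).trans (ENNReal.ofReal_le_ofReal (Real.exp_le_exp.2 ?_))
  have hpos : 0 < 1 - r := by linarith
  have hsum : ∑ j ∈ Finset.range n, r ^ (j + 1) ≤ 1 / (1 - r) := by
    calc ∑ j ∈ Finset.range n, r ^ (j + 1) ≤ ∑ j ∈ Finset.range n, r ^ j :=
          Finset.sum_le_sum fun j _ => pow_le_pow_of_le_one hr0 hr1.le (Nat.le_succ j)
      _ ≤ ∑' j, r ^ j := (summable_geometric_of_lt_one hr0 hr1).sum_le_tsum _
          fun j _ => pow_nonneg hr0 j
      _ = 1 / (1 - r) := by rw [tsum_geometric_of_lt_one hr0 hr1, one_div]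
  rw [sq, ← div_div]
  gcongr

/-! ### Densities of the laws -/

lemma posSemidef_corrMatrix {ρ : ℝ} (hρ : ρ ^ 2 ≤ 1) : (corrMatrix ρ).PosSemidef := by
  refine Matrix.PosSemidef.of_dotProduct_mulVec_nonneg ?_ fun x => ?_
  · ext i j
    fin_cases i <;> fin_cases j <;> simp [corrMatrix]
  · simp [corrMatrix, Matrix.mulVec, dotProduct, Fin.sum_univ_two]
    nlinarith [sq_nonneg (x 0 + ρ * x 1), mul_nonneg (sub_nonneg.2 hρ) (sq_nonneg (x 1))]

/-- A correlated Gaussian pair as a linear image of an independent one. -/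
lemma pairLaw_eq_map {ρ : ℝ} (hρ : ρ ^ 2 ≤ 1) :
    pairLaw ρ = ((gaussianReal 0 1).prod (gaussianReal 0 1)).map
      fun p => !₂[p.1, ρ * p.1 + √(1 - ρ ^ 2) * p.2] := by
  have hmeas : Measurable fun p : ℝ × ℝ => !₂[p.1, ρ * p.1 + √(1 - ρ ^ 2) * p.2] := by
    fun_prop
  have hprob := Measure.isProbabilityMeasure_map
    (μ := (gaussianReal 0 1).prod (gaussianReal 0 1)) hmeas.aemeasurable
  unfold pairLaw
  refine Measure.ext_of_charFun (funext fun t => ?_)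
  rw [charFun_multivariateGaussian (posSemidef_corrMatrix hρ), charFun_apply,
    integral_map hmeas.aemeasurable (by fun_prop)]
  have key : ∀ p : ℝ × ℝ,
      Complex.exp ((inner ℝ !₂[p.1, ρ * p.1 + √(1 - ρ ^ 2) * p.2] t : ℝ) * Complex.I) =
      Complex.exp (((t 0 + ρ * t 1 : ℝ) : ℂ) * p.1 * Complex.I) *
        Complex.exp (((√(1 - ρ ^ 2) * t 1 : ℝ) : ℂ) * p.2 * Complex.I) := by
    intro p
    rw [← Complex.exp_add]
    congr 1
    simp [PiLp.inner_apply, Fin.sum_univ_two]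
    ring
  simp_rw [key]
  rw [integral_prod_mul (fun u : ℝ => Complex.exp (((t 0 + ρ * t 1 : ℝ) : ℂ) * u * Complex.I))
      (fun v : ℝ => Complex.exp (((√(1 - ρ ^ 2) * t 1 : ℝ) : ℂ) * v * Complex.I)),
    ← charFun_apply_real, ← charFun_apply_real, charFun_gaussianReal, charFun_gaussianReal,
    ← Complex.exp_add]
  congr 1
  have hs : ((√(1 - ρ ^ 2) : ℝ) : ℂ) ^ 2 = 1 - (ρ : ℂ) ^ 2 := by
    rw [← Complex.ofReal_pow, Real.sq_sqrt (by linarith)]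
    push_cast
    ring
  simp [corrMatrix, Matrix.mulVec, dotProduct, Fin.sum_univ_two, mul_pow, hs]
  ring

/-- The standard Gaussian measure with the Mehler kernel as density is a normal law. -/
lemma lintegral_mehler_mul {ρ : ℝ} (hρ : ρ ^ 2 < 1) (x : ℝ) {f : ℝ → ℝ≥0∞} (hf : Measurable f) :
    ∫⁻ y, mehler ρ x y * f y ∂gaussianReal 0 1 =
      ∫⁻ y, f (ρ * x + √(1 - ρ ^ 2) * y) ∂gaussianReal 0 1 := by
  have hv : (1 - ρ ^ 2).toNNReal ≠ 0 := by simpa using hρ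
  have hmap : (gaussianReal 0 1).map (fun y => ρ * x + √(1 - ρ ^ 2) * y) =
      gaussianReal (ρ * x) (1 - ρ ^ 2).toNNReal := by
    have : (fun y => ρ * x + √(1 - ρ ^ 2) * y) = (ρ * x + ·) ∘ (√(1 - ρ ^ 2) * ·) := rfl
    rw [this, ← Measure.map_map (by fun_prop) (by fun_prop), gaussianReal_map_const_mul,
      gaussianReal_map_const_add]
    congr 1
    · simp
    · ext
      simp [Real.sq_sqrt (sub_nonneg.2 hρ.le), hρ.le]
  rw [← lintegral_map (μ := gaussianReal 0 1) (f := f) hf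
      (g := fun y => ρ * x + √(1 - ρ ^ 2) * y) (by fun_prop), hmap,
    lintegral_stdGaussian_eq _ (by fun_prop), gaussianReal_of_var_ne_zero _ hv,
    lintegral_withDensity_eq_lintegral_mul _ (measurable_gaussianPDF _ _) hf]
  refine lintegral_congr fun y => ?_
  rw [← mul_assoc, gaussianPDF_mul_mehler hρ, Pi.mul_apply]

/-- The law of a correlated Gaussian pair, through its density. -/
def pairDensityLaw (ρ : ℝ) : Measure (ℝ × ℝ) :=
  ((gaussianReal 0 1).prod (gaussianReal 0 1)).withDensity fun p => mehler ρ p.1 p.2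

lemma pairDensityLaw_eq_map {ρ : ℝ} (hρ : ρ ^ 2 < 1) :
    pairDensityLaw ρ = ((gaussianReal 0 1).prod (gaussianReal 0 1)).map
      fun p => (p.1, ρ * p.1 + √(1 - ρ ^ 2) * p.2) := by
  refine Measure.ext_of_lintegral _ fun f hf => ?_
  rw [lintegral_map hf (by fun_prop), pairDensityLaw,
    lintegral_withDensity_eq_lintegral_mul _ (by fun_prop) hf,
    lintegral_prod _ (by fun_prop), lintegral_prod _ (by fun_prop)]
  refine lintegral_congr fun x => ?_
  exact lintegral_mehler_mul hρ x (f := fun y => f (x, y)) (by fun_prop)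

lemma isProbabilityMeasure_pairDensityLaw {ρ : ℝ} (hρ : ρ ^ 2 < 1) :
    IsProbabilityMeasure (pairDensityLaw ρ) := by
  rw [pairDensityLaw_eq_map hρ]
  exact Measure.isProbabilityMeasure_map (by fun_prop)

lemma pairLaw_eq_map_pairDensityLaw {ρ : ℝ} (hρ : ρ ^ 2 < 1) :
    pairLaw ρ = (pairDensityLaw ρ).map fun p => !₂[p.1, p.2] := by
  rw [pairLaw_eq_map hρ.le, pairDensityLaw_eq_map hρ, Measure.map_map (by fun_prop) (by fun_prop)]
  rfl

lemma pi_withDensity_eq {X : Type*} [MeasurableSpace X] (μ : Measure X) [SigmaFinite μ]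
    {f : X → ℝ≥0∞} (hf : Measurable f) [SigmaFinite (μ.withDensity f)] (n : ℕ) :
    Measure.pi (fun _ : Fin n => μ.withDensity f) =
      (Measure.pi fun _ : Fin n => μ).withDensity fun x => ∏ i, f (x i) := by
  refine Measure.pi_eq fun s hs => ?_
  rw [withDensity_apply _ (MeasurableSet.univ_pi hs),
    ← lintegral_indicator (MeasurableSet.univ_pi hs)]
  have key : ∀ x : Fin n → X, (Set.univ.pi s).indicator (fun x => ∏ i, f (x i)) x =
      ∏ i, (s i).indicator f (x i) := by
    intro x
    by_cases hx : x ∈ Set.univ.pi s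
    · rw [Set.indicator_of_mem hx]
      exact Finset.prod_congr rfl fun i _ =>
        (Set.indicator_of_mem (hx i (Set.mem_univ i)) f).symm
    · rw [Set.indicator_of_notMem hx]
      simp only [Set.mem_pi, Set.mem_univ, true_implies, not_forall] at hx
      obtain ⟨i, hi⟩ := hx
      exact (Finset.prod_eq_zero (Finset.mem_univ i) (Set.indicator_of_notMem hi f)).symm
  simp_rw [key]
  rw [lintegral_pi_prod μ fun i => hf.indicator (hs i)]
  refine Finset.prod_congr rfl fun i _ => ?_
  rw [lintegral_indicator (hs i), withDensity_apply _ (hs i)]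

lemma map_withDensity_comp {α β : Type*} [MeasurableSpace α] [MeasurableSpace β] {μ : Measure α}
    {ν : Measure β} {T : α → β} (hT : MeasurePreserving T μ ν) {f : β → ℝ≥0∞}
    (hf : Measurable f) : (μ.withDensity fun x => f (T x)).map T = ν.withDensity f := by
  ext s hs
  rw [Measure.map_apply hT.measurable hs, withDensity_apply _ (hT.measurable hs),
    withDensity_apply _ hs, hT.setLIntegral_comp_preimage hs hf]

/-- The standard Gaussian measure on the observation space. -/
def stdObs (n : ℕ) : Measure (Obs n) :=
  (Measure.pi fun _ : Fin n => gaussianReal 0 1).prod (Measure.pi fun _ : Fin n => gaussianReal 0 1)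

instance (n : ℕ) : IsProbabilityMeasure (stdObs n) := by unfold stdObs; infer_instance

lemma measurePreserving_stdObs {n : ℕ} (σ : Equiv.Perm (Fin n)) :
    MeasurePreserving (fun w : Fin n → ℝ × ℝ =>
        ((fun i => (w i).1, fun j => (w (σ.symm j)).2) : Obs n))
      (Measure.pi fun _ : Fin n => (gaussianReal 0 1).prod (gaussianReal 0 1)) (stdObs n) := by
  have h1 := measurePreserving_arrowProdEquivProdArrow ℝ ℝ (Fin n)
    (fun _ => gaussianReal 0 1) (fun _ => gaussianReal 0 1)
  have h2 := measurePreserving_piCongrLeft (α := fun _ : Fin n => ℝ)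
    (fun _ : Fin n => gaussianReal 0 1) σ
  have h3 := ((MeasurePreserving.id (Measure.pi fun _ : Fin n => gaussianReal 0 1)).prod h2).comp h1
  unfold stdObs
  convert h3 using 1
  funext w
  refine Prod.ext rfl (funext fun j => ?_)
  obtain ⟨i, rfl⟩ := σ.surjective j
  simp only [Function.comp_apply, Prod.map_snd]
  rw [MeasurableEquiv.coe_piCongrLeft, Equiv.piCongrLeft_apply_apply, Equiv.symm_apply_apply]
  rfl

/-- The likelihood ratio of the observation given the permutation. -/
def likelihood {n : ℕ} (ρ : ℝ) (σ : Equiv.Perm (Fin n)) (p : Obs n) : ℝ≥0∞ :=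
  ∏ i, mehler ρ (p.1 i) (p.2 (σ i))

@[fun_prop]
lemma measurable_likelihood {n : ℕ} (ρ : ℝ) (σ : Equiv.Perm (Fin n)) :
    Measurable (likelihood ρ σ) := by
  unfold likelihood
  fun_prop

lemma altLawGiven_eq_withDensity {n : ℕ} {ρ : ℝ} (hρ : ρ ^ 2 < 1) (σ : Equiv.Perm (Fin n)) :
    altLawGiven n ρ σ = (stdObs n).withDensity (likelihood ρ σ) := by
  have hprob := isProbabilityMeasure_pairDensityLaw hρ
  have hE : Measurable fun p : ℝ × ℝ => !₂[p.1, p.2] := by fun_prop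
  have hprob' : IsProbabilityMeasure ((pairDensityLaw ρ).map fun p => !₂[p.1, p.2]) :=
    Measure.isProbabilityMeasure_map hE.aemeasurable
  have hU : Measurable (unmatch σ) := by unfold unmatch; fun_prop
  have hpi : Measure.pi (fun _ : Fin n => pairLaw ρ) =
      (Measure.pi fun _ : Fin n => pairDensityLaw ρ).map fun w i => !₂[(w i).1, (w i).2] := by
    rw [Measure.pi_map_pi (fun _ => hE.aemeasurable), ← pairLaw_eq_map_pairDensityLaw hρ]
  rw [altLawGiven, hpi, Measure.map_map hU (by fun_prop)]
  unfold pairDensityLaw at hprob ⊢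
  rw [pi_withDensity_eq _ (by fun_prop),
    ← map_withDensity_comp (measurePreserving_stdObs σ) (measurable_likelihood ρ σ)]
  congr 1
  simp [likelihood]

lemma nullLaw_eq_stdObs (n : ℕ) : nullLaw n = stdObs n := by
  have h := altLawGiven_eq_withDensity (n := n) (ρ := 0) (by norm_num) 1
  have h1 : likelihood (n := n) 0 1 = 1 := by
    funext p
    simp [likelihood, mehler_zero]
  rw [h1, withDensity_one] at h
  exact h

/-! ### Second moment of the likelihood ratio -/

/-- Given `X`, the integral over `Y` factorizes: `y j` links only `x (σ⁻¹ j)` and `x (τ⁻¹ j)`, and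
the semigroup property joins these by the kernel of parameter `ρ * ρ`. -/
lemma lintegral_likelihood_mul_likelihood {n : ℕ} {ρ : ℝ} (hρ : ρ ^ 2 < 1)
    (σ τ : Equiv.Perm (Fin n)) :
    ∫⁻ p, likelihood ρ σ p * likelihood ρ τ p ∂stdObs n =
      ∫⁻ x, ∏ i, mehler (ρ ^ 2) (x i) (x ((τ⁻¹ * σ) i))
        ∂Measure.pi (fun _ : Fin n => gaussianReal 0 1) := by
  rw [stdObs, lintegral_prod _ (by fun_prop)]
  refine lintegral_congr fun x => ?_
  have key : ∀ y : Fin n → ℝ, likelihood ρ σ (x, y) * likelihood ρ τ (x, y) =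
      ∏ j, mehler ρ (x (σ⁻¹ j)) (y j) * mehler ρ (y j) (x (τ⁻¹ j)) := by
    intro y
    rw [Finset.prod_mul_distrib, ← Equiv.prod_comp σ, ← Equiv.prod_comp τ fun j =>
      mehler ρ (y j) (x (τ⁻¹ j))]
    simp [likelihood, mehler_comm ρ (y _)]
  simp_rw [key]
  rw [lintegral_pi_prod (gaussianReal 0 1)
    (f := fun j t => mehler ρ (x (σ⁻¹ j)) t * mehler ρ t (x (τ⁻¹ j))) (fun j => by fun_prop)]
  simp_rw [lintegral_mehler_mul_mehler hρ hρ]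
  rw [← Equiv.prod_comp σ]
  simp [sq]

/-- The likelihood ratio of the observation, averaged over the permutation. -/
def mixtureLikelihood (n : ℕ) (ρ : ℝ) (p : Obs n) : ℝ≥0∞ :=
  (n.factorial : ℝ≥0∞)⁻¹ * ∑ σ : Equiv.Perm (Fin n), likelihood ρ σ p

@[fun_prop]
lemma measurable_mixtureLikelihood (n : ℕ) (ρ : ℝ) : Measurable (mixtureLikelihood n ρ) := by
  unfold mixtureLikelihood
  fun_prop

lemma altLaw_apply_eq {n : ℕ} {ρ : ℝ} (hρ : ρ ^ 2 < 1) {s : Set (Obs n)} (hs : MeasurableSet s) :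
    altLaw n ρ s = ∫⁻ p in s, mixtureLikelihood n ρ p ∂stdObs n := by
  simp only [altLaw, mixtureLikelihood, altLawGiven_eq_withDensity hρ]
  rw [lintegral_const_mul _ (by fun_prop), lintegral_finsetSum _ (by fun_prop)]
  simp [Measure.finsetSum_apply, withDensity_apply _ hs]

/-- The second moment of the likelihood ratio is the generating function of the nondecreasing
tuples. -/
lemma lintegral_mixtureLikelihood_sq (n : ℕ) {ρ : ℝ} (hρ : ρ ^ 2 < 1) :
    ∫⁻ p, mixtureLikelihood n ρ p ^ 2 ∂stdObs n = monotoneSum n (ENNReal.ofReal (ρ ^ 2)) := by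
  have hn0 : (n.factorial : ℝ≥0∞) ≠ 0 := by exact_mod_cast n.factorial_ne_zero
  have hn1 : (n.factorial : ℝ≥0∞) ≠ ∞ := ENNReal.natCast_ne_top _
  have hsum : ∀ τ : Equiv.Perm (Fin n), ∑ σ : Equiv.Perm (Fin n),
      ∫⁻ p, likelihood ρ σ p * likelihood ρ τ p ∂stdObs n =
        n.factorial * monotoneSum n (ENNReal.ofReal (ρ ^ 2)) := by
    intro τ
    simp_rw [lintegral_likelihood_mul_likelihood hρ]
    -- For fixed `τ`, the product `τ⁻¹ * σ` runs over all permutations.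
    rw [← sum_perm_tsum_fixed, ← Equiv.sum_comp (Equiv.mulLeft τ⁻¹) fun π =>
      ∑' k : Fin n → ℕ, if k ∘ π = k then ENNReal.ofReal (ρ ^ 2) ^ ∑ i, k i else 0]
    exact Finset.sum_congr rfl fun σ _ =>
      lintegral_prod_mehler_perm (sq_nonneg ρ) hρ (τ⁻¹ * σ)
  simp_rw [mixtureLikelihood, mul_pow, sq (∑ σ, likelihood ρ σ _), Finset.sum_mul_sum]
  rw [lintegral_const_mul _ (by fun_prop), lintegral_finsetSum _ (by fun_prop),
    Finset.sum_congr rfl fun σ _ => lintegral_finsetSum _ (by fun_prop), Finset.sum_comm]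
  simp_rw [hsum]
  simp only [Finset.sum_const, Finset.card_univ, Fintype.card_perm, Fintype.card_fin, nsmul_eq_mul]
  rw [sq, mul_mul_mul_comm, ← mul_assoc _ _ (monotoneSum _ _), ← mul_assoc,
    ENNReal.inv_mul_cancel hn0 hn1, one_mul, one_mul]

instance (n : ℕ) (ρ : ℝ) : IsProbabilityMeasure (altLaw n ρ) where
  measure_univ := by
    have hn0 : (n.factorial : ℝ≥0∞) ≠ 0 := by exact_mod_cast n.factorial_ne_zero
    have hn1 : (n.factorial : ℝ≥0∞) ≠ ∞ := ENNReal.natCast_ne_top _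
    have hpair : IsProbabilityMeasure (pairLaw ρ) := by unfold pairLaw; infer_instance
    have h : ∀ σ, altLawGiven n ρ σ Set.univ = 1 := fun σ => by
      have hU : Measurable (unmatch σ) := by unfold unmatch; fun_prop
      rw [altLawGiven, Measure.map_apply hU MeasurableSet.univ, Set.preimage_univ, measure_univ]
    simp [altLaw, Measure.finsetSum_apply, h, Fintype.card_perm, ENNReal.inv_mul_cancel hn0 hn1]

/-! ### From the second moment to the risk -/

lemma lintegral_sq_le_measure_mul {α : Type*} [MeasurableSpace α] (μ : Measure α) (s : Set α)
    {f : α → ℝ≥0∞} (hf : AEMeasurable f μ) :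
    (∫⁻ x in s, f x ∂μ) ^ 2 ≤ μ s * ∫⁻ x, f x ^ 2 ∂μ := by
  have h := ENNReal.lintegral_mul_le_Lp_mul_Lq (μ.restrict s) Real.HolderConjugate.two_two
    (f := fun _ => 1) aemeasurable_const hf.restrict
  simp only [Pi.mul_apply, one_mul, one_pow, lintegral_one, Measure.restrict_apply_univ,
    ENNReal.rpow_two] at h
  calc (∫⁻ x in s, f x ∂μ) ^ 2
      ≤ (μ s ^ (1 / 2 : ℝ) * (∫⁻ x in s, f x ^ 2 ∂μ) ^ (1 / 2 : ℝ)) ^ 2 := by gcongr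
    _ = μ s * ∫⁻ x in s, f x ^ 2 ∂μ := by
      rw [mul_pow, ← ENNReal.rpow_natCast, ← ENNReal.rpow_natCast, ← ENNReal.rpow_mul,
        ← ENNReal.rpow_mul]
      norm_num
    _ ≤ _ := by gcongr; exact Measure.restrict_le_self

lemma altLaw_real_sq_le {n : ℕ} {ρ r : ℝ} (hr : r < 1) (hρ : ρ ^ 2 ≤ r) {s : Set (Obs n)}
    (hs : MeasurableSet s) :
    (altLaw n ρ).real s ^ 2 ≤ (nullLaw n).real s * Real.exp (1 / (1 - r) ^ 2) := by
  have hρ1 : ρ ^ 2 < 1 := hρ.trans_lt hr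
  have h : altLaw n ρ s ^ 2 ≤ nullLaw n s * ENNReal.ofReal (Real.exp (1 / (1 - r) ^ 2)) := by
    rw [altLaw_apply_eq hρ1 hs, nullLaw_eq_stdObs]
    refine (lintegral_sq_le_measure_mul _ s (by fun_prop)).trans ?_
    rw [lintegral_mixtureLikelihood_sq n hρ1]
    gcongr
    refine (monotoneSum_le (sq_nonneg ρ) hρ1 n).trans ?_
    have : 0 < 1 - r := by linarith
    gcongr
  have hfin : nullLaw n s ≠ ∞ := by
    rw [nullLaw_eq_stdObs]
    exact measure_ne_top _ _
  have h2 := ENNReal.toReal_mono (ENNReal.mul_ne_top hfin ENNReal.ofReal_ne_top) h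
  rwa [ENNReal.toReal_pow, ENNReal.toReal_mul, ENNReal.toReal_ofReal (Real.exp_pos _).le] at h2

lemma le_risk {n : ℕ} {ρ r : ℝ} (hr : r < 1) (hρ : ρ ^ 2 ≤ r) {φ : Obs n → Fin 2}
    (hφ : Measurable φ) : (4 * Real.exp (1 / (1 - r) ^ 2))⁻¹ ≤ risk n ρ φ := by
  have hs : MeasurableSet {p | φ p = 1} := hφ (measurableSet_singleton 1)
  have hcompl : {p | φ p = 0} = {p | φ p = 1}ᶜ := by
    ext p
    simp only [Set.mem_ofPred_eq, Set.mem_compl_iff]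
    omega
  have hsq := altLaw_real_sq_le hr hρ hs
  rw [risk, hcompl, probReal_compl_eq_one_sub hs]
  set M := Real.exp (1 / (1 - r) ^ 2) with hM
  have hM1 : 1 ≤ M := Real.one_le_exp (by positivity)
  have hp : 0 ≤ (nullLaw n).real {p | φ p = 1} := measureReal_nonneg
  have hq : (altLaw n ρ).real {p | φ p = 1} ≤ 1 := measureReal_le_one
  generalize (nullLaw n).real {p | φ p = 1} = p at *
  generalize (altLaw n ρ).real {p | φ p = 1} = q at *
  -- A risk `p + 1 - q` below `1 / (4M) ≤ 1 / 4` forces `q > 3 / 4`, yet `q ^ 2 ≤ p * M < 1 / 4`.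
  by_contra! hlt
  have hMi : (4 * M)⁻¹ * M = 1 / 4 := by
    field_simp
  have hle : (4 * M)⁻¹ ≤ 1 / 4 := by
    rw [one_div]
    exact inv_anti₀ (by norm_num) (by linarith)
  have h1 : p * M < 1 / 4 := by
    rw [← hMi]
    exact mul_lt_mul_of_pos_right (by linarith) (by linarith)
  nlinarith

lemma le_bayesRisk {n : ℕ} {ρ r : ℝ} (hr : r < 1) (hρ : ρ ^ 2 ≤ r) :
    (4 * Real.exp (1 / (1 - r) ^ 2))⁻¹ ≤ bayesRisk n ρ := by
  have : Nonempty {φ : Obs n → Fin 2 // Measurable φ} := ⟨⟨fun _ => 0, measurable_const⟩⟩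
  exact le_ciInf fun φ => le_risk hr hρ φ.2

end PermutedCorrelation

end

theorem theorem1 (ρ : ℕ → ℝ) (n : ℕ → ℕ) (hρ : ∀ k, |ρ k| ≤ 1)
    (hΩ : PermutedCorrelation.IsBigOmega (fun k => 1 - ρ k ^ 2) (fun _ => 1)) :
    PermutedCorrelation.IsBigOmega
        (fun k => PermutedCorrelation.bayesRisk (n k) (ρ k)) (fun _ => 1) ∧
      ¬ PermutedCorrelation.StrongDetection ρ n := by
  obtain ⟨C, hC, h⟩ := hΩ
  -- `1 ≤ C * (1 - ρ ^ 2)` means `ρ ^ 2 ≤ 1 - C⁻¹`, so `r = 1 - C⁻¹` serves for all `k`.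
  have hr : 1 - C⁻¹ < 1 := by linarith [inv_pos.2 hC]
  have hle : ∀ k, ρ k ^ 2 ≤ 1 - C⁻¹ := fun k => by
    have := (inv_le_iff_one_le_mul₀' hC).2 (h k)
    linarith
  have hbound := fun k => PermutedCorrelation.le_bayesRisk (n := n k) hr (hle k)
  set M := 4 * Real.exp (1 / (1 - (1 - C⁻¹)) ^ 2)
  have hM : 0 < M := by positivity
  refine ⟨⟨M, hM, fun k => ?_⟩, fun hlim => ?_⟩
  · exact (inv_le_iff_one_le_mul₀' hM).1 (hbound k)
  · exact (inv_pos.2 hM).not_ge (ge_of_tendsto' hlim hbound)
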